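/- Let $n\ge 0$ and let $\vec\kappa=\langle\kappa_0,\dots,\kappa_n\rangle$ be a tuple of cardinals. Write $\alpha(\kappa_i)=\kappa_i\sqcup\{\infty\}$ for the one-point compactification of the discrete space of size $\kappa_i$, put $X(\vec\kappa)=\prod_{i\le n}\alpha(\kappa_i)$, and let $X(\vec\kappa)^-$ be the subspace obtained by deleting the point $(\infty,\dots,\infty)$. For $A\subseteq\{0,\dots,n\}$ let $$\mathcal D_A=\{\vec x\in X(\vec\kappa): x_i\ne\infty\text{ for all }i\in A\},\qquad F_A=\{\vec x\in X(\vec\kappa): x_i\neq\infty\iff i\in A\},$$ and for $\vec x\in F_A$ and finite sets $\mathcal E_j\subseteq\kappa_j$ $(j\notin A)$ let $$\mathcal N_A(\vec x,\vec{\mathcal E})=\{\vec y\in X(\vec\kappa): y_i=x_i\text{ for all }i\in A,\text{ and } y_j=\infty\text{ or }y_j\notin\mathcal E_j\text{ for all }j\notin A\}.$$ For an integer $-1\le k\le n$, a $k$-Fubini partition of $X(\vec\kappa)^-$ is a family $\langle Y_i: i\le n\rangle$ of pairwise disjoint (possibly empty) sets with union $X(\vec\kappa)^-$ such that for every $A\subseteq\{0,\dots,n\}$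 with $|A|\ge k+1$: 1. for every $i\notin A$ the set $Y_i\cap\mathcal D_A$ is clopen in $\mathcal D_A$; and 2. for every $\vec x\in F_A$ there are finite sets $\mathcal E_j\subseteq\kappa_j$ $(j\notin A)$ with $\mathcal N_A(\vec x,\vec{\mathcal E})\subseteq\bigcup_{i\in A}Y_i$. Theorem. Let $-1\le k\le n$ and suppose that $X(\vec\kappa)^-$ admits a $k$-Fubini partition. Then, for sheaf cohomology with coefficients in the constant sheaf $\underline{\mathbb Z_2}$ with value $\mathbb Z_2=\mathbb Z/2\mathbb Z$: (i) $H^{\ell}(X(\vec\kappa)^-,\underline{\mathbb Z_2})=0$ for all $\ell\ge k+1$; in particular $H^{k+1}(X(\vec\kappa)^-,\underline{\mathbb Z_2})=0$. (ii) If $k\ge0$, then for every tuple of cardinals $\vec\lambda=\langle\lambda_0,\dots,\lambda_n\rangle$ with $\lambda_i\le\kappa_i$ for all $i\le n$ there is an injective group homomorphism $$H^k(X(\vec\lambda)^-,\underline{\mathbb Z_2})\hookrightarrow H^k(X(\vec\kappa)^-,\underline{\mathbb Z_2}).$$ -/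

import Mathlib

open CategoryTheory

universe u

namespace Cuboid

/-- The discrete space whose set of points is the chosen representative of the cardinal `c`. -/
def Disc (c : Cardinal.{u}) : Type u := c.out

instance (c : Cardinal.{u}) : TopologicalSpace (Disc c) := ⊥

instance (c : Cardinal.{u}) : DiscreteTopology (Disc c) := ⟨rfl⟩

variable {n : ℕ}

/-- `X(κ) = ∏ i, α(κ i)`, where `α` is the one-point compactification of a discrete space. -/
abbrev Space (κ : Fin (n + 1) → Cardinal.{u}) : Type u :=
  ∀ i, OnePoint (Disc (κ i))

/-- The point `(∞, …, ∞)` of `X(κ)`. -/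
def inftyPt (κ : Fin (n + 1) → Cardinal.{u}) : Space κ :=
  fun _ => OnePoint.infty

/-- `X(κ)⁻`, that is `X(κ)` with the point `(∞, …, ∞)` deleted, as a topological space. -/
def Punctured (κ : Fin (n + 1) → Cardinal.{u}) : TopCat.{u} :=
  TopCat.of {x : Space κ // x ≠ inftyPt κ}

/-- `D_A`: the points all of whose coordinates with index in `A` are different from `∞`. -/
def D (κ : Fin (n + 1) → Cardinal.{u}) (A : Finset (Fin (n + 1))) : Set (Space κ) :=
  {x | ∀ i ∈ A, x i ≠ OnePoint.infty}

/-- The facet `F_A`: the coordinates different from `∞` are exactly those with index in `A`. -/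
def Facet (κ : Fin (n + 1) → Cardinal.{u}) (A : Finset (Fin (n + 1))) : Set (Space κ) :=
  {x | ∀ i, x i ≠ OnePoint.infty ↔ i ∈ A}

/-- The basic open set `N_A(x, E)`; only the finite sets `E j` with `j ∉ A` matter. -/
def Nbhd (κ : Fin (n + 1) → Cardinal.{u}) (A : Finset (Fin (n + 1))) (x : Space κ)
    (E : ∀ j, Finset (Disc (κ j))) : Set (Space κ) :=
  {y | (∀ i ∈ A, y i = x i) ∧
    ∀ j, j ∉ A → y j = OnePoint.infty ∨ ∃ z : Disc (κ j), z ∉ E j ∧ y j = (z : OnePoint _)}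

/-- `Y` is a `k`-Fubini partition of `X(κ)⁻` (pieces are allowed to be empty). -/
structure IsFubini (κ : Fin (n + 1) → Cardinal.{u}) (k : ℤ)
    (Y : Fin (n + 1) → Set (Space κ)) : Prop where
  disjoint : Pairwise fun i j => Disjoint (Y i) (Y j)
  cover : ⋃ i, Y i = {x | x ≠ inftyPt κ}
  clopen : ∀ A : Finset (Fin (n + 1)), k + 1 ≤ (A.card : ℤ) → ∀ i, i ∉ A →
    IsClopen {x : D κ A | (x : Space κ) ∈ Y i}
  nbhd : ∀ A : Finset (Fin (n + 1)), k + 1 ≤ (A.card : ℤ) → ∀ x ∈ Facet κ A,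
    ∃ E : ∀ j, Finset (Disc (κ j)), Nbhd κ A x E ⊆ ⋃ i ∈ A, Y i

/-- The constant sheaf of abelian groups with value `ℤ/2` on a topological space. -/
noncomputable def constZ2 (X : TopCat.{u}) :
    Sheaf (Opens.grothendieckTopology X) AddCommGrpCat.{u} :=
  (constantSheaf (Opens.grothendieckTopology X) AddCommGrpCat.{u}).obj
    (AddCommGrpCat.of (ULift.{u} (ZMod 2)))

/-- The sheaf cohomology group `H^m(X(κ)⁻, ℤ/2)`. -/
noncomputable abbrev H (m : ℕ) (κ : Fin (n + 1) → Cardinal.{u}) : Type u :=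
  Sheaf.H.{u} (constZ2 (Punctured κ)) m

end Cuboid

section

open Opposite TopologicalSpace

/-- The presheaf of locally constant functions with values in `ℤ/2`. -/
noncomputable def lcPresheaf (T : TopCat.{u}) : (Opens T)ᵒᵖ ⥤ AddCommGrpCat.{u} where
  obj U := AddCommGrpCat.of (LocallyConstant U.unop (ZMod 2))
  map {U V} i := AddCommGrpCat.ofHom
    { toFun := fun f => f.comap ⟨fun x => ⟨x.1, i.unop.le x.2⟩, by fun_prop⟩
      map_zero' := rfl
      map_add' := fun _ _ => rfl }
  map_id _ := rfl
  map_comp _ _ := rfl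

theorem lcPresheaf_isSheaf (T : TopCat.{u}) :
    Presheaf.IsSheaf (Opens.grothendieckTopology T) (lcPresheaf T) := by
  refine (TopCat.Presheaf.isSheaf_iff_isSheafUniqueGluing (X := T) (lcPresheaf T)).2 ?_
  intro ι U sf hsf
  change ∀ i, LocallyConstant (U i) (ZMod 2) at sf
  have hsf' : ∀ i j (x : T) (hi : x ∈ U i) (hj : x ∈ U j), sf i ⟨x, hi⟩ = sf j ⟨x, hj⟩ := by
    intro i j x hi hj
    exact congrArg (fun f : LocallyConstant (U i ⊓ U j : Opens T) (ZMod 2) => f ⟨x, hi, hj⟩)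
      (hsf i j)
  have hmem : ∀ x : (iSup U : Opens T), ∃ i, x.1 ∈ U i := fun x => Opens.mem_iSup.1 x.2
  choose c hc using hmem
  let g : LocallyConstant (iSup U : Opens T) (ZMod 2) :=
    ⟨fun x => sf (c x) ⟨x.1, hc x⟩, by
      refine (IsLocallyConstant.iff_eventually_eq _).2 fun x => ?_
      have h1 : ∀ᶠ y : U (c x) in nhds ⟨x.1, hc x⟩, sf (c x) y = sf (c x) ⟨x.1, hc x⟩ :=
        (sf (c x)).isLocallyConstant.eventually_eq _
      have h2 : ∀ᶠ y : T in nhds x.1, ∀ hy : y ∈ U (c x),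
          sf (c x) ⟨y, hy⟩ = sf (c x) ⟨x.1, hc x⟩ := by
        rw [(U (c x)).isOpen.isOpenEmbedding_subtypeVal.nhds_eq_comap ⟨x.1, hc x⟩] at h1
        exact (Filter.eventually_comap.1 h1).mono fun y hy hy' => hy _ rfl
      have h3 : ∀ᶠ y : T in nhds x.1, y ∈ U (c x) := (U (c x)).isOpen.mem_nhds (hc x)
      filter_upwards [continuous_subtype_val.continuousAt.eventually (h2.and h3)] with y hy
      exact (hsf' _ _ y.1 _ hy.2).trans (hy.1 hy.2)⟩
  refine ⟨g, fun i => ?_, fun f hf => ?_⟩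
  · refine LocallyConstant.ext (X := U i) fun x => ?_
    exact hsf' _ _ _ _ _
  · change LocallyConstant (iSup U : Opens T) (ZMod 2) at f
    refine LocallyConstant.ext (X := (iSup U : Opens T)) fun x => ?_
    exact congrArg (fun f : LocallyConstant (U (c x)) (ZMod 2) => f ⟨x.1, hc x⟩) (hf (c x))

/-- The sheaf of locally constant functions with values in `ℤ/2`. -/
noncomputable def lcSheaf (T : TopCat.{u}) :
    Sheaf (Opens.grothendieckTopology T) AddCommGrpCat.{u} :=
  ⟨lcPresheaf T, lcPresheaf_isSheaf T⟩

/-- The comparison from the constant presheaf to locally constant functions. -/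
noncomputable def constToLc (T : TopCat.{u}) :
    (Functor.const (Opens T)ᵒᵖ).obj (AddCommGrpCat.of (ULift.{u} (ZMod 2))) ⟶ lcPresheaf T where
  app U := AddCommGrpCat.ofHom
    { toFun := fun a => LocallyConstant.const U.unop a.down
      map_zero' := rfl
      map_add' := fun _ _ => rfl }
  naturality _ _ _ := rfl

instance constToLc_isLocallyInjective (T : TopCat.{u}) :
    Presheaf.IsLocallyInjective (Opens.grothendieckTopology T) (constToLc T) where
  equalizerSieve_mem {U} a b h := by
    intro x hx
    refine ⟨U.unop, 𝟙 _, ?_, hx⟩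
    have : a = b := ULift.ext _ _ (congrArg (fun f : LocallyConstant U.unop (ZMod 2) => f ⟨x, hx⟩) h)
    subst this
    rfl

instance constToLc_isLocallySurjective (T : TopCat.{u}) :
    Presheaf.IsLocallySurjective (Opens.grothendieckTopology T) (constToLc T) where
  imageSieve_mem {U} f := by
    intro x hx
    change LocallyConstant U (ZMod 2) at f
    obtain ⟨V, hV, hxV, hfV⟩ := f.isLocallyConstant.exists_open ⟨x, hx⟩
    refine ⟨⟨Subtype.val '' V, U.isOpen.isOpenMap_subtype_val _ hV⟩,
      homOfLE (by rintro _ ⟨y, -, rfl⟩; exact y.2), ⟨ULift.up (f ⟨x, hx⟩), ?_⟩, ⟨_, hxV, rfl⟩⟩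
    refine LocallyConstant.ext (X := (⟨Subtype.val '' V, U.isOpen.isOpenMap_subtype_val _ hV⟩ :
      Opens T)) ?_
    rintro ⟨_, y, hy, rfl⟩
    exact (hfV y hy).symm

/-- The constant sheaf `ℤ/2` is the sheaf of locally constant functions. -/
theorem nonempty_constZ2_iso_lcSheaf (T : TopCat.{u}) :
    Nonempty (Cuboid.constZ2 T ≅ lcSheaf T) := by
  let c : (Functor.const (Opens T)ᵒᵖ).obj (AddCommGrpCat.of (ULift.{u} (ZMod 2))) ⟶
    (lcSheaf T).obj := constToLc T
  let l := sheafifyLift (Opens.grothendieckTopology T) c (lcSheaf T).property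
  have hfac : toSheafify (Opens.grothendieckTopology T) _ ≫ l = c :=
    toSheafify_sheafifyLift _ _ _
  have : Presheaf.IsLocallyInjective (Opens.grothendieckTopology T) c :=
    constToLc_isLocallyInjective T
  have : Presheaf.IsLocallySurjective (Opens.grothendieckTopology T) c :=
    constToLc_isLocallySurjective T
  have h1 : Presheaf.IsLocallyInjective (Opens.grothendieckTopology T) l :=
    Presheaf.isLocallyInjective_of_isLocallyInjective_of_isLocallySurjective_fac _ _ hfac
  have h2 : Presheaf.IsLocallySurjective (Opens.grothendieckTopology T) l :=
    Presheaf.isLocallySurjective_of_isLocallySurjective_fac _ hfac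
  let l' : Cuboid.constZ2 T ⟶ lcSheaf T := ⟨l⟩
  have : IsIso l' := (Sheaf.isLocallyBijective_iff_isIso l').1 ⟨h1, h2⟩
  exact ⟨asIso l'⟩

end

section

open Opposite TopologicalSpace Topology Filter

section Refinable

/-- Clopen sets form a basis of the topology. -/
def HasClopenBasis (T : Type*) [TopologicalSpace T] : Prop :=
  ∀ x : T, ∀ W ∈ 𝓝 x, ∃ C, IsClopen C ∧ x ∈ C ∧ C ⊆ W

/-- Every neighbourhood assignment on `U` admits a locally constant choice of centres. -/
def LcRefinable {T : Type*} [TopologicalSpace T] (U : Set T) : Prop :=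
  ∀ W : T → Set T, (∀ x ∈ U, W x ∈ 𝓝 x) →
    ∃ c : T → T, ∀ y ∈ U, c y ∈ U ∧ y ∈ W (c y) ∧ ∀ᶠ z in 𝓝 y, c z = c y

variable {T : Type*} [TopologicalSpace T]

theorem IsCompact.lcRefinable (hb : HasClopenBasis T)
    {K : Set T} (hK : IsCompact K) : LcRefinable K := by
  intro W hW
  have key : ∃ c : T → T, ∃ N, IsClopen N ∧ K ⊆ N ∧
      ∀ y ∈ N, c y ∈ K ∧ y ∈ W (c y) ∧ ∀ᶠ z in 𝓝 y, c z = c y := by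
    refine hK.induction_on (p := fun s => ∃ c : T → T, ∃ N, IsClopen N ∧ s ⊆ N ∧
      ∀ y ∈ N, c y ∈ K ∧ y ∈ W (c y) ∧ ∀ᶠ z in 𝓝 y, c z = c y) ?_ ?_ ?_ ?_
    · exact ⟨id, ∅, isClopen_empty, subset_rfl, by simp⟩
    · rintro s t hst ⟨c, N, hN, hs, h⟩
      exact ⟨c, N, hN, hst.trans hs, h⟩
    · rintro s t ⟨c, N, hN, hs, h⟩ ⟨c', N', hN', hs', h'⟩
      classical
      refine ⟨fun y => if y ∈ N then c y else c' y, N ∪ N', hN.union hN',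
        Set.union_subset_union hs hs', fun y hy => ?_⟩
      by_cases hyN : y ∈ N
      · obtain ⟨h1, h2, h3⟩ := h y hyN
        simp only [hyN, if_true]
        refine ⟨h1, h2, ?_⟩
        filter_upwards [h3, hN.isOpen.mem_nhds hyN] with z hz hzN
        simp only [hzN, if_true, hz]
      · obtain ⟨h1, h2, h3⟩ := h' y (hy.resolve_left hyN)
        simp only [hyN, if_false]
        refine ⟨h1, h2, ?_⟩
        filter_upwards [h3, hN.compl.isOpen.mem_nhds hyN] with z hz hzN
        simp only [show z ∉ N from hzN, if_false, hz]
    · intro x hx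
      obtain ⟨C, hC, hxC, hCW⟩ := hb x (W x) (hW x hx)
      exact ⟨C, mem_nhdsWithin_of_mem_nhds (hC.isOpen.mem_nhds hxC), fun _ => x, C, hC,
        subset_rfl, fun y hy => ⟨hx, hCW hy, Eventually.of_forall fun _ => rfl⟩⟩
  obtain ⟨c, N, -, hKN, h⟩ := key
  exact ⟨c, fun y hy => h y (hKN hy)⟩

theorem LcRefinable.iUnion {ι : Type*} {K : ι → Set T} (hK : ∀ i, LcRefinable (K i))
    (hKo : ∀ i, IsOpen (K i)) (hd : ∀ i j x, x ∈ K i → x ∈ K j → i = j) :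
    LcRefinable (⋃ i, K i) := by
  intro W hW
  choose c hc using fun i => hK i W fun x hx => hW x (Set.mem_iUnion_of_mem i hx)
  classical
  refine ⟨fun y => if h : ∃ i, y ∈ K i then c h.choose y else y, fun y hy => ?_⟩
  obtain ⟨i, hi⟩ := Set.mem_iUnion.1 hy
  have hch : ∀ z ∈ K i, (if h : ∃ i, z ∈ K i then c h.choose z else z) = c i z := by
    intro z hz
    have h : ∃ i, z ∈ K i := ⟨i, hz⟩
    rw [dif_pos h, hd _ _ _ h.choose_spec hz]
  obtain ⟨h1, h2, h3⟩ := hc i y hi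
  simp only [hch y hi]
  refine ⟨Set.mem_iUnion_of_mem i h1, h2, ?_⟩
  filter_upwards [h3, (hKo i).mem_nhds hi] with z hz hzK
  simp only [hch z hzK, hz]

end Refinable

section Acyclic

variable {T : TopCat.{u}}

/-- Sheaves of abelian groups on a topological space. -/
abbrev AbSheaf (T : TopCat.{u}) := Sheaf (Opens.grothendieckTopology T) AddCommGrpCat.{u}

theorem AbSheaf.eq_of_isEmpty (F : AbSheaf T) {U : Opens T} (hU : ∀ x, x ∉ U)
    (s t : F.obj.obj (op U)) : s = t :=
  TopCat.Sheaf.eq_of_locally_eq' (X := T) (F := F) (fun i : PEmpty.{u+1} => i.elim) U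
    (fun i => i.elim) (fun x hx => (hU x hx).elim) s t (fun i => i.elim)

theorem AbSheaf.surjective_app_of_epi {F G : AbSheaf T} (g : F ⟶ G) [hg : Epi g] {U : Opens T}
    (hU : LcRefinable (U : Set T)) : Function.Surjective (g.hom.app (op U)) := by
  intro s
  have hls := (TopCat.Presheaf.isLocallySurjective_iff (X := T) g.hom).1
    ((TopCat.Sheaf.isLocallySurjective_iff_epi (X := T) g).2 hg) U s
  have hls' : ∀ x : T, ∃ V : Opens T, ∃ h : V ≤ U, ∃ t : F.obj.obj (op V),
      g.hom.app (op V) t = G.obj.map (homOfLE h).op s ∧ (x ∈ U → x ∈ V) := by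
    intro x
    by_cases hx : x ∈ U
    · obtain ⟨V, h, ⟨t, ht⟩, hxV⟩ := hls x hx
      exact ⟨V, h, t, ht, fun _ => hxV⟩
    · exact ⟨⊥, bot_le, 0, AbSheaf.eq_of_isEmpty G (U := ⊥) (fun x hx => hx) _ _, fun h => (hx h).elim⟩
  choose V hVU t ht hxV using hls'
  obtain ⟨c, hc⟩ := hU (fun x => V x) fun x hx => (V x).isOpen.mem_nhds (hxV x hx)
  let O : T → Opens T := fun x => ⟨{y | y ∈ U ∧ c y = x}, by
    refine isOpen_iff_mem_nhds.2 fun y hy => ?_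
    filter_upwards [U.isOpen.mem_nhds hy.1, (hc y hy.1).2.2] with z h1 h2
    exact ⟨h1, h2.trans hy.2⟩⟩
  have hOV : ∀ x, O x ≤ V x := by
    rintro x y ⟨hy, rfl⟩
    exact (hc y hy).2.1
  have hOU : ∀ x, O x ≤ U := fun x y hy => hy.1
  have hcov : U ≤ iSup O := fun y hy => Opens.mem_iSup.2 ⟨c y, hy, rfl⟩
  obtain ⟨r, hr, -⟩ := TopCat.Sheaf.existsUnique_gluing' (X := T) (F := F) O U
    (fun x => homOfLE (hOU x)) hcov (fun x => F.obj.map (homOfLE (hOV x)).op (t x)) (by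
      intro x y
      by_cases hxy : x = y
      · subst hxy; rfl
      · exact AbSheaf.eq_of_isEmpty F (U := O x ⊓ O y) (fun z hz => hxy (hz.1.2.symm.trans hz.2.2)) _ _)
  refine ⟨r, TopCat.Sheaf.eq_of_locally_eq' (X := T) (F := G) O U
    (fun x => homOfLE (hOU x)) hcov _ _ fun x => ?_⟩
  have h1 := NatTrans.naturality_apply g.hom (homOfLE (hOU x)).op r
  have h2 := NatTrans.naturality_apply g.hom (homOfLE (hOV x)).op (t x)
  have hr := hr x
  erw [← h1, hr, h2, ht, ← ConcreteCategory.comp_apply, ← G.obj.map_comp]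
  rfl

/-- Direct image of abelian sheaves. -/
noncomputable abbrev AbSheaf.push {E X : TopCat.{u}} (p : E ⟶ X) : AbSheaf E ⥤ AbSheaf X :=
  (Opens.map p).sheafPushforwardContinuous AddCommGrpCat.{u} _ _

instance AbSheaf.push_additive {E X : TopCat.{u}} (p : E ⟶ X) :
    (AbSheaf.push p).Additive where

theorem AbSheaf.injective_push {E X : TopCat.{u}} (p : E ⟶ X) (I : AbSheaf E) [Injective I] :
    Injective ((AbSheaf.push p).obj I) := by
  have : Limits.ReflectsLimits (forget AddCommGrpCat.{u}) :=
    Limits.reflectsLimits_of_reflectsIsomorphisms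
  have : Limits.PreservesFiniteLimits ((Opens.map p).sheafPullback AddCommGrpCat.{u}
      (Opens.grothendieckTopology X) (Opens.grothendieckTopology E)) :=
    Functor.sheafPullbackConstruction.preservesFiniteLimits _ _ _ _
  have : ((Opens.map p).sheafPullback AddCommGrpCat.{u}
      (Opens.grothendieckTopology X) (Opens.grothendieckTopology E)).PreservesMonomorphisms :=
    preservesMonomorphisms_of_preservesLimitsOfShape _
  exact Injective.injective_of_adjoint
    ((Opens.map p).sheafAdjunctionContinuous AddCommGrpCat.{u} _ _) I

/-- Preimages of arbitrarily small open sets are refinable. -/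
def SmallRefinable {E X : TopCat.{u}} (p : E ⟶ X) : Prop :=
  ∀ (x : X) (U : Opens X), x ∈ U → ∃ V : Opens X, x ∈ V ∧ V ≤ U ∧ LcRefinable (p ⁻¹' (V : Set X))

theorem AbSheaf.shortExact_push {E X : TopCat.{u}} (p : E ⟶ X) (hp : SmallRefinable p)
    {S : ShortComplex (AbSheaf E)} (hS : S.ShortExact) : (S.map (AbSheaf.push p)).ShortExact := by
  have hm := hS.mono_f
  have he := hS.epi_g
  have h1 := ((Functor.preservesFiniteLimits_tfae (AbSheaf.push p)).out 1 3 rfl rfl).mpr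
    inferInstance S ⟨hS.exact, hS.mono_f⟩
  have := h1.2
  have h2 : Epi (S.map (AbSheaf.push p)).g := by
    refine (TopCat.Sheaf.isLocallySurjective_iff_epi (X := X) _).1
      ((TopCat.Presheaf.isLocallySurjective_iff (X := X) _).2 fun U s x hx => ?_)
    obtain ⟨V, hxV, hVU, hV⟩ := hp x U hx
    obtain ⟨t, ht⟩ := AbSheaf.surjective_app_of_epi S.g (U := (Opens.map p).obj V) hV
      (((AbSheaf.push p).obj S.X₃).obj.map (homOfLE hVU).op s)
    exact ⟨V, hVU, ⟨t, ht⟩, hxV⟩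
  exact { exact := h1.1, mono_f := h1.2, epi_g := h2 }

open Abelian in
theorem AbSheaf.surjective_H_map_zero {X : TopCat.{u}} {F G : AbSheaf X} (g : F ⟶ G)
    (hg : Function.Surjective (g.hom.app (op ⊤))) : Function.Surjective (Sheaf.H.map g 0) := by
  intro y
  have hT : Limits.IsTerminal (⊤ : Opens X) := Limits.isTerminalTop
  obtain ⟨s, hs⟩ := hg (Sheaf.H.equiv₀ G hT y)
  refine ⟨(Sheaf.H.equiv₀ F hT).symm s, ?_⟩
  rw [Sheaf.H.equiv₀_symm_naturality, hs, AddEquiv.symm_apply_apply]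

open Abelian in
theorem AbSheaf.subsingleton_H_push {E X : TopCat.{u}} (p : E ⟶ X) (hp : SmallRefinable p)
    (hE : LcRefinable (Set.univ : Set E)) (q : ℕ) :
    ∀ G : AbSheaf E, Subsingleton (Sheaf.H ((AbSheaf.push p).obj G) (q + 1)) := by
  induction q with
  | zero =>
    intro G
    let S : ShortComplex (AbSheaf E) := ShortComplex.mk (Injective.ι G) (Limits.cokernel.π _)
      (Limits.cokernel.condition _)
    have hS : S.ShortExact := { exact := ShortComplex.exact_cokernel _ }
    have hS' := AbSheaf.shortExact_push p hp hS
    have : Injective (S.map (AbSheaf.push p)).X₂ := AbSheaf.injective_push p (Injective.under G)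
    have he := hS.epi_g
    refine subsingleton_of_forall_eq 0 fun x => ?_
    obtain ⟨y, hy⟩ := Ext.covariant_sequence_exact₁ _ hS' x (Ext.eq_zero_of_injective _) rfl
    obtain ⟨z, hz⟩ := AbSheaf.surjective_H_map_zero (S.map (AbSheaf.push p)).g
      (AbSheaf.surjective_app_of_epi S.g (U := (Opens.map p).obj ⊤) hE) y
    rw [← hy, ← hz, Sheaf.H.map_apply, Ext.comp_assoc_of_second_deg_zero,
      ShortComplex.ShortExact.comp_extClass, Ext.comp_zero]
    rfl
  | succ q ih =>
    intro G
    let S : ShortComplex (AbSheaf E) := ShortComplex.mk (Injective.ι G) (Limits.cokernel.π _)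
      (Limits.cokernel.condition _)
    have hS : S.ShortExact := { exact := ShortComplex.exact_cokernel _ }
    have hS' := AbSheaf.shortExact_push p hp hS
    have : Injective (S.map (AbSheaf.push p)).X₂ := AbSheaf.injective_push p (Injective.under G)
    refine subsingleton_of_forall_eq 0 fun x => ?_
    obtain ⟨y, hy⟩ := Ext.covariant_sequence_exact₁ _ hS' x (Ext.eq_zero_of_injective _) rfl
    have hy0 : y = 0 := (ih S.X₃).elim _ _
    rw [← hy, hy0, Ext.zero_comp]
    rfl

end Acyclic

end

section

open Opposite TopologicalSpace Topology Filter Limits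

namespace AbSheaf

variable {X : TopCat.{u}}

theorem injective_app_of_mono {F G : AbSheaf X} (f : F ⟶ G) [Mono f] (U : Opens X) :
    Function.Injective (f.hom.app (op U)) := by
  have : Mono ((sheafToPresheaf (Opens.grothendieckTopology X) AddCommGrpCat.{u}).map f) :=
    inferInstance
  have : Mono (f.hom.app (op U)) := (NatTrans.mono_iff_mono_app f.hom).1 this (op U)
  exact (AddCommGrpCat.mono_iff_injective _).1 this

theorem exists_kernel_section {F G : AbSheaf X} (f : F ⟶ G) {U : Opens X}
    (s : F.obj.obj (op U)) (hs : f.hom.app (op U) s = 0) :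
    ∃ t, (kernel.ι f).hom.app (op U) t = s :=
  TopCat.Sheaf.sections_exact_of_left_exact (X := X)
    (S := ShortComplex.mk (C := AbSheaf X) (kernel.ι f) f (kernel.condition f))
    (ShortComplex.exact_kernel f) (inferInstanceAs (Mono (kernel.ι f))) s hs

theorem comp_app_apply {F G K : AbSheaf X} (f : F ⟶ G) (g : G ⟶ K) {U : Opens X}
    (s : F.obj.obj (op U)) :
    (f ≫ g).hom.app (op U) s = g.hom.app (op U) (f.hom.app (op U) s) := rfl

theorem app_kernel_section {F G : AbSheaf X} (f : F ⟶ G) {U : Opens X}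
    (t : (kernel f).obj.obj (op U)) :
    f.hom.app (op U) ((kernel.ι f).hom.app (op U) t) = 0 := by
  rw [← comp_app_apply, kernel.condition]
  rfl

/-- Every local section of `G` killed by `g` is locally in the image of `f`. -/
def LocallyExact {F G K : AbSheaf X} (f : F ⟶ G) (g : G ⟶ K) : Prop :=
  ∀ (U : Opens X) (s : G.obj.obj (op U)), g.hom.app (op U) s = 0 → ∀ x ∈ U,
    ∃ (V : Opens X) (h : V ≤ U), x ∈ V ∧
      ∃ t : F.obj.obj (op V), f.hom.app (op V) t = G.obj.map (homOfLE h).op s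

theorem LocallyExact.epi_lift {F G K : AbSheaf X} {f : F ⟶ G} {g : G ⟶ K} (w : f ≫ g = 0)
    (h : LocallyExact f g) : Epi (kernel.lift g f w) := by
  refine (TopCat.Sheaf.isLocallySurjective_iff_epi (X := X) _).1
    ((TopCat.Presheaf.isLocallySurjective_iff (X := X) _).2 fun U s x hx => ?_)
  obtain ⟨V, hV, hxV, t, ht⟩ := h U _ (app_kernel_section g s) x hx
  refine ⟨V, hV, ⟨t, injective_app_of_mono (kernel.ι g) V ?_⟩, hxV⟩
  rw [← comp_app_apply, kernel.lift_ι, ht]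
  exact (NatTrans.naturality_apply (kernel.ι g).hom (homOfLE hV).op s).symm

/-- Global sections of a kernel are the kernel on global sections. -/
noncomputable def kernelSections {F G : AbSheaf X} (f : F ⟶ G) (U : Opens X) :
    (kernel f).obj.obj (op U) ≃+ (f.hom.app (op U)).hom.ker :=
  AddEquiv.ofBijective (((kernel.ι f).hom.app (op U)).hom.codRestrict _
    fun t => app_kernel_section f t)
    ⟨fun _ _ h => injective_app_of_mono (kernel.ι f) U (congrArg Subtype.val h),
      fun s => (exists_kernel_section f s.1 s.2).imp fun _ h => Subtype.ext h⟩

section Shift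

variable (C : ℕ → AbSheaf X) (d : ∀ l, C l ⟶ C (l + 1)) (w : ∀ l, d l ≫ d (l + 1) = 0)

/-- The sequence of cocycles, cochains and boundaries. -/
noncomputable abbrev cocycleSequence (l : ℕ) : ShortComplex (AbSheaf X) :=
  ShortComplex.mk (kernel.ι (d l)) (kernel.lift (d (l + 1)) (d l) (w l)) (by
    rw [← cancel_mono (kernel.ι _), Category.assoc, kernel.lift_ι, kernel.condition, zero_comp])

variable {C d}

theorem cocycleSequence_shortExact (hex : ∀ l, LocallyExact (d l) (d (l + 1))) (l : ℕ) :
    (cocycleSequence C d w l).ShortExact := by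
  have h1 : Mono (cocycleSequence C d w l).f := inferInstanceAs (Mono (kernel.ι (d l)))
  have h2 : Epi (cocycleSequence C d w l).g := (hex l).epi_lift (w l)
  refine { exact := ?_ }
  refine ShortComplex.exact_of_f_is_kernel _ (KernelFork.IsLimit.ofι' _ _ fun {A} k hk => ?_)
  refine ⟨kernel.lift (d l) k ?_, kernel.lift_ι _ _ _⟩
  have hk' : k ≫ kernel.lift (d (l + 1)) (d l) (w l) = 0 := hk
  change k ≫ d l = 0
  rw [← kernel.lift_ι (d (l + 1)) (d l) (w l), ← Category.assoc, hk', zero_comp]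

open Abelian in
theorem exists_cocycles_to_H (w : ∀ l, d l ≫ d (l + 1) = 0)
    (hex : ∀ l, LocallyExact (d l) (d (l + 1)))
    (hac : ∀ l q, Subsingleton (Sheaf.H (C l) (q + 1))) (m : ℕ) :
    ∀ l N, l + m = N →
      ∃ π : ((d (N + 1)).hom.app (op ⊤)).hom.ker →+ Sheaf.H (kernel (d l)) (m + 1),
        Function.Surjective π ∧
        ∀ z, π z = 0 ↔ ∃ y, (d N).hom.app (op ⊤) y = z.1 := by
  have hT : IsTerminal (⊤ : Opens X) := isTerminalTop
  induction m with
  | zero =>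
    rintro l N rfl
    have hS := cocycleSequence_shortExact w hex l
    let e : Sheaf.H (kernel (d (l + 1))) 0 ≃+ ((d (l + 1)).hom.app (op ⊤)).hom.ker :=
      (Sheaf.H.equiv₀ (kernel (d (l + 1))) hT).trans (kernelSections (d (l + 1)) ⊤)
    let δ : Sheaf.H (kernel (d (l + 1))) 0 →+ Sheaf.H (kernel (d l)) 1 :=
      hS.extClass.postcomp _ rfl
    have hδ : Function.Surjective δ := fun x => by
      have := hac l 0
      exact Ext.covariant_sequence_exact₁ _ hS x (Subsingleton.elim (α := Sheaf.H (C l) 1) _ _) rfl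
    have hm : ∀ x : Sheaf.H (C l) 0, ((e (Sheaf.H.map (cocycleSequence C d w l).g 0 x)).1) =
        (d l).hom.app (op ⊤) (Sheaf.H.equiv₀ (C l) hT x) := by
      intro x
      change (kernel.ι (d (l + 1))).hom.app (op ⊤) (Sheaf.H.equiv₀ _ hT _) = _
      rw [← Sheaf.H.equiv₀_naturality]
      change (kernel.lift (d (l + 1)) (d l) (w l) ≫ kernel.ι (d (l + 1))).hom.app (op ⊤) _ = _
      rw [kernel.lift_ι]
    refine ⟨δ.comp e.symm.toAddMonoidHom, hδ.comp e.symm.surjective, fun z => ⟨fun h => ?_, ?_⟩⟩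
    · obtain ⟨x, hx⟩ := Ext.covariant_sequence_exact₃ _ hS (e.symm z) rfl h
      refine ⟨Sheaf.H.equiv₀ (C l) hT x, ?_⟩
      refine (hm x).symm.trans ?_
      have hx' : Sheaf.H.map (cocycleSequence C d w l).g 0 x = e.symm z := hx
      rw [hx', e.apply_symm_apply]
    · rintro ⟨y, hy⟩
      have hz : e.symm z = Sheaf.H.map (cocycleSequence C d w l).g 0
          ((Sheaf.H.equiv₀ (C l) hT).symm y) := by
        refine e.symm_apply_eq.2 (Subtype.ext ?_)
        rw [hm]
        refine hy.symm.trans ?_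
        rw [AddEquiv.apply_symm_apply]
        rfl
      change δ (e.symm z) = 0
      rw [hz]
      change Ext.comp (Ext.comp _ _ (add_zero 0)) hS.extClass (zero_add 1) = 0
      rw [Ext.comp_assoc_of_second_deg_zero, ShortComplex.ShortExact.comp_extClass, Ext.comp_zero]
  | succ m ih =>
    intro l N hN
    obtain ⟨π, hπ, hker⟩ := ih (l + 1) N (by omega)
    have hS := cocycleSequence_shortExact w hex l
    let δ : Sheaf.H (kernel (d (l + 1))) (m + 1) →+ Sheaf.H (kernel (d l)) (m + 1 + 1) :=
      hS.extClass.postcomp _ rfl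
    have hδ : Function.Surjective δ := fun x => by
      have := hac l (m + 1)
      exact Ext.covariant_sequence_exact₁ _ hS x
        (Subsingleton.elim (α := Sheaf.H (C l) (m + 1 + 1)) _ _) rfl
    have hδ' : ∀ x, δ x = 0 → x = 0 := fun x hx => by
      obtain ⟨y, rfl⟩ := Ext.covariant_sequence_exact₃ _ hS x rfl hx
      have := hac l m
      have hy : y = 0 := Subsingleton.elim (α := Sheaf.H (C l) (m + 1)) _ _
      rw [hy, Ext.zero_comp]
    refine ⟨δ.comp π, hδ.comp hπ, fun z => ?_⟩
    rw [← hker z]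
    exact ⟨hδ' _, fun h => by simp [h]⟩

end Shift

/-- An isomorphism of sheaves induces isomorphisms in cohomology. -/
noncomputable def hCongr {F G : AbSheaf X} (e : F ≅ G) (m : ℕ) : Sheaf.H F m ≃+ Sheaf.H G m where
  toFun := Sheaf.H.map e.hom m
  invFun := Sheaf.H.map e.inv m
  left_inv x := by rw [← Sheaf.H.map_comp_apply, e.hom_inv_id, Sheaf.H.map_id_apply]
  right_inv x := by rw [← Sheaf.H.map_comp_apply, e.inv_hom_id, Sheaf.H.map_id_apply]
  map_add' := map_add _

end AbSheaf

end

section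

open Opposite TopologicalSpace Topology Filter Limits

namespace Cech

section Algebra

variable {I : Type*} [DecidableEq I]

theorem sum_sum_erase_erase (φ : Finset I → ZMod 2) (B : Finset I) :
    ∑ a ∈ B, ∑ b ∈ B.erase a, φ ((B.erase a).erase b) = 0 := by
  rw [Finset.sum_sigma']
  refine Finset.sum_involution (fun p _ => ⟨p.2, p.1⟩) ?_ ?_ ?_ ?_
  · rintro ⟨a, b⟩ -
    rw [Finset.erase_right_comm]
    exact CharTwo.add_self_eq_zero _
  · rintro ⟨a, b⟩ h - heq
    simp only [Finset.mem_sigma, Finset.mem_erase] at h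
    exact h.2.1 (congrArg Sigma.fst heq)
  · rintro ⟨a, b⟩ h
    simp only [Finset.mem_sigma, Finset.mem_erase] at h ⊢
    exact ⟨h.2.2, Ne.symm h.2.1, h.1⟩
  · rintro ⟨a, b⟩ -
    rfl

/-- Coning off a cocycle at a vertex `i` recovers the cocycle as a coboundary. -/
theorem sum_cone (φ : Finset I → ZMod 2) (i : I) (B : Finset I)
    (h : i ∉ B → ∑ c ∈ insert i B, φ ((insert i B).erase c) = 0) :
    ∑ b ∈ B, (if i ∈ B.erase b then 0 else φ (insert i (B.erase b))) = φ B := by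
  by_cases hi : i ∈ B
  · rw [Finset.sum_eq_single_of_mem i hi]
    · simp [Finset.insert_erase hi]
    · intro b _ hb
      rw [if_pos (Finset.mem_erase.2 ⟨hb.symm, hi⟩)]
  · have h' := h hi
    rw [Finset.sum_insert hi, Finset.erase_insert hi] at h'
    have h2 : ∀ b ∈ B, (if i ∈ B.erase b then 0 else φ (insert i (B.erase b))) =
        φ ((insert i B).erase b) := by
      intro b hb
      have hib : i ≠ b := fun h => hi (h ▸ hb)
      rw [if_neg fun h => hi (Finset.mem_of_mem_erase h), Finset.erase_insert_of_ne hib]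
    rw [Finset.sum_congr rfl h2]
    exact (CharTwo.add_eq_zero.1 h').symm

end Algebra

variable {X : TopCat.{u}} {I : Type} (D : I → Opens X)

/-- The intersection of the members of a family of open sets with index in `A`. -/
def inter (A : Finset I) : Opens X :=
  ⟨{x | ∀ i ∈ A, x ∈ D i}, by
    have : {x | ∀ i ∈ A, x ∈ D i} = ⋂ i ∈ A, (D i : Set X) := by ext; simp
    rw [this]
    exact isOpen_biInter_finset fun i _ => (D i).isOpen⟩

theorem mem_inter {A : Finset I} {x : X} : x ∈ inter D A ↔ ∀ i ∈ A, x ∈ D i := Iff.rfl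

theorem inter_anti {A B : Finset I} (h : A ⊆ B) : inter D B ≤ inter D A :=
  fun _ hx i hi => hx i (h hi)

/-- The disjoint union of the `(l+1)`-fold intersections. -/
def total (l : ℕ) : TopCat.{u} :=
  TopCat.of (Σ A : {A : Finset I // A.card = l + 1}, inter D A.1)

/-- The projection of the disjoint union of intersections. -/
def proj (l : ℕ) : total D l ⟶ X :=
  TopCat.ofHom ⟨fun e => e.2.1, continuous_sigma fun _ => continuous_subtype_val⟩

/-- The sheaf of Čech cochains with values in `ℤ/2`. -/
noncomputable def cochains (l : ℕ) : AbSheaf X := (AbSheaf.push (proj D l)).obj (lcSheaf (total D l))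

/-- Sections of the sheaf of cochains. -/
abbrev Cochain (l : ℕ) (U : Opens X) : Type u :=
  LocallyConstant ((Opens.map (proj D l)).obj U) (ZMod 2)

variable {D} {l : ℕ} {U V : Opens X}

open Classical in
/-- The value of a cochain, extended by zero. -/
noncomputable def Cochain.val (f : Cochain D l U) (A : Finset I) (x : X) : ZMod 2 :=
  if h : A.card = l + 1 ∧ x ∈ inter D A ∧ x ∈ U then f ⟨⟨⟨A, h.1⟩, ⟨x, h.2.1⟩⟩, h.2.2⟩ else 0

theorem Cochain.val_of_mem (f : Cochain D l U) {A : Finset I} {x : X} (hA : A.card = l + 1)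
    (hx : x ∈ inter D A) (hU : x ∈ U) : f.val A x = f ⟨⟨⟨A, hA⟩, ⟨x, hx⟩⟩, hU⟩ :=
  dif_pos ⟨hA, hx, hU⟩

theorem Cochain.ext_val {f g : Cochain D l U}
    (h : ∀ A x, A.card = l + 1 → x ∈ inter D A → x ∈ U → f.val A x = g.val A x) : f = g := by
  ext ⟨⟨⟨A, hA⟩, ⟨x, hx⟩⟩, hU⟩
  have := h A x hA hx hU
  rwa [f.val_of_mem hA hx hU, g.val_of_mem hA hx hU] at this

theorem Cochain.val_add (f g : Cochain D l U) (A : Finset I) (x : X) :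
    (f + g).val A x = f.val A x + g.val A x := by
  unfold Cochain.val
  split_ifs
  · rfl
  · simp

@[simp]
theorem Cochain.val_zero (A : Finset I) (x : X) : (0 : Cochain D l U).val A x = 0 := by
  unfold Cochain.val
  split_ifs <;> rfl

theorem Cochain.val_eventually (f : Cochain D l U) {A : Finset I} {x : X} (hA : A.card = l + 1)
    (hx : x ∈ inter D A) (hU : x ∈ U) : ∀ᶠ y in 𝓝 x, f.val A y = f.val A x := by
  let e : (inter D A ⊓ U : Opens X) → (Opens.map (proj D l)).obj U :=
    fun y => ⟨⟨⟨A, hA⟩, ⟨y.1, y.2.1⟩⟩, y.2.2⟩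
  have he : Continuous e := by
    refine Continuous.subtype_mk ?_ _
    exact continuous_sigmaMk.comp (by fun_prop)
  have h1 : ∀ᶠ y in 𝓝 (⟨x, hx, hU⟩ : (inter D A ⊓ U : Opens X)), f (e y) = f (e ⟨x, hx, hU⟩) :=
    he.continuousAt.eventually (f.isLocallyConstant.eventually_eq _)
  rw [(inter D A ⊓ U).isOpen.isOpenEmbedding_subtypeVal.nhds_eq_comap ⟨x, hx, hU⟩] at h1
  filter_upwards [Filter.eventually_comap.1 h1, (inter D A ⊓ U).isOpen.mem_nhds ⟨hx, hU⟩]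
    with y hy hy'
  rw [f.val_of_mem hA hx hU, f.val_of_mem hA hy'.1 hy'.2]
  exact hy ⟨y, hy'⟩ rfl

/-- A cochain from a function that is locally constant where it matters. -/
def Cochain.mk (φ : Finset I → X → ZMod 2)
    (h : ∀ A x, A.card = l + 1 → x ∈ inter D A → x ∈ U → ∀ᶠ y in 𝓝 x, φ A y = φ A x) :
    Cochain D l U :=
  ⟨fun e => φ e.1.1.1 e.1.2.1, by
    refine (IsLocallyConstant.iff_eventually_eq _).2 ?_
    rintro ⟨⟨⟨A, hA⟩, ⟨x, hx⟩⟩, hU⟩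
    have h1 : ∀ᶠ e in 𝓝 (⟨⟨A, hA⟩, ⟨x, hx⟩⟩ :
        Σ A : {A : Finset I // A.card = l + 1}, inter D A.1), φ e.1.1 e.2.1 = φ A x := by
      rw [Sigma.nhds_mk, Filter.eventually_map]
      exact (continuous_subtype_val.continuousAt (x := (⟨x, hx⟩ : inter D A))).eventually
        (h A x hA hx hU)
    have h2 := (continuous_subtype_val
      (p := fun e : total D l => e ∈ (Opens.map (proj D l)).obj U)).continuousAt
        (x := ⟨⟨⟨A, hA⟩, ⟨x, hx⟩⟩, hU⟩)
    exact Tendsto.eventually (p := fun e : total D l => φ e.1.1 e.2.1 = φ A x) h2 h1⟩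

theorem Cochain.val_mk {φ : Finset I → X → ZMod 2}
    {h : ∀ A x, A.card = l + 1 → x ∈ inter D A → x ∈ U → ∀ᶠ y in 𝓝 x, φ A y = φ A x}
    {A : Finset I} {x : X} (hA : A.card = l + 1) (hx : x ∈ inter D A) (hU : x ∈ U) :
    (Cochain.mk φ h).val A x = φ A x :=
  Cochain.val_of_mem _ hA hx hU

theorem Cochain.val_map (f : Cochain D l U) (h : V ≤ U) {A : Finset I} {x : X} (hV : x ∈ V) :
    Cochain.val (U := V) ((cochains D l).obj.map (homOfLE h).op f) A x = f.val A x := by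
  unfold Cochain.val
  by_cases h' : A.card = l + 1 ∧ x ∈ inter D A
  · rw [dif_pos ⟨h'.1, h'.2, hV⟩, dif_pos ⟨h'.1, h'.2, h hV⟩]
    rfl
  · rw [dif_neg fun h => h' ⟨h.1, h.2.1⟩, dif_neg fun h => h' ⟨h.1, h.2.1⟩]

variable (D) in
/-- The augmentation, restricting a locally constant function to the members of the cover. -/
noncomputable def aug : lcSheaf X ⟶ cochains D 0 :=
  ⟨{ app := fun U => AddCommGrpCat.ofHom
      (AddMonoidHom.mk' (fun f : LocallyConstant U.unop (ZMod 2) =>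
        (f.comap ⟨fun e => ⟨(proj D 0).hom e.1, e.2⟩, by fun_prop⟩ : Cochain D 0 U.unop))
        fun _ _ => rfl)
     naturality := fun _ _ _ => rfl }⟩

theorem val_aug (f : LocallyConstant U (ZMod 2)) {A : Finset I} {x : X} (hA : A.card = 0 + 1)
    (hx : x ∈ inter D A) (hU : x ∈ U) :
    Cochain.val (l := 0) ((aug D).hom.app (op U) f) A x = f ⟨x, hU⟩ :=
  Cochain.val_of_mem (D := D) (l := 0) (U := U) _ hA hx hU

theorem mono_aug (hcov : ∀ x, ∃ i, x ∈ D i) : Mono (aug D) := by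
  have : ∀ U, Mono ((aug D).hom.app U) := by
    intro U
    refine (AddCommGrpCat.mono_iff_injective _).2 fun f g hfg => ?_
    change LocallyConstant U.unop (ZMod 2) at f g
    refine LocallyConstant.ext fun x => ?_
    obtain ⟨i, hi⟩ := hcov x.1
    have h : (({i} : Finset I)).card = 0 + 1 := rfl
    have hx : x.1 ∈ inter D {i} := (mem_inter D).2 (by simpa using hi)
    exact (val_aug f h hx x.2).symm.trans ((congrArg (fun c => Cochain.val (l := 0) (U := U.unop)
      c {i} x.1) hfg).trans (val_aug g h hx x.2))
  have : Mono (aug D).hom := NatTrans.mono_of_mono_app _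
  exact (sheafToPresheaf (Opens.grothendieckTopology X) AddCommGrpCat.{u}).mono_of_mono_map this

variable [DecidableEq I]

/-- The Čech differential mod 2. -/
noncomputable def Cochain.d (f : Cochain D l U) : Cochain D (l + 1) U :=
  Cochain.mk (fun A x => ∑ a ∈ A, f.val (A.erase a) x) fun A x hA hx hU => by
    have : ∀ᶠ y in 𝓝 x, ∀ a ∈ A, f.val (A.erase a) y = f.val (A.erase a) x :=
      (Finset.eventually_all A).2 fun a ha => f.val_eventually
        (by rw [Finset.card_erase_of_mem ha, hA]; rfl) (inter_anti D (A.erase_subset a) hx) hU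
    filter_upwards [this] with y hy
    exact Finset.sum_congr rfl hy

theorem Cochain.val_d (f : Cochain D l U) {A : Finset I} {x : X} (hA : A.card = l + 1 + 1)
    (hx : x ∈ inter D A) (hU : x ∈ U) : f.d.val A x = ∑ a ∈ A, f.val (A.erase a) x :=
  Cochain.val_mk hA hx hU

theorem Cochain.d_add (f g : Cochain D l U) : (f + g).d = f.d + g.d := by
  refine Cochain.ext_val fun A x hA hx hU => ?_
  simp only [Cochain.val_add, Cochain.val_d _ hA hx hU, Finset.sum_add_distrib]

theorem Cochain.d_d (f : Cochain D l U) : f.d.d = 0 := by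
  refine Cochain.ext_val fun A x hA hx hU => ?_
  rw [Cochain.val_d _ hA hx hU, Cochain.val_zero, ← sum_sum_erase_erase (fun B => f.val B x) A]
  refine Finset.sum_congr rfl fun a ha => ?_
  exact Cochain.val_d _ (by rw [Finset.card_erase_of_mem ha, hA]; rfl)
    (inter_anti D (A.erase_subset a) hx) hU

variable (D) in
/-- The Čech differential as a morphism of sheaves. -/
noncomputable def diff (l : ℕ) : cochains D l ⟶ cochains D (l + 1) :=
  ⟨{ app := fun U => AddCommGrpCat.ofHom (AddMonoidHom.mk' (Cochain.d (U := U.unop)) Cochain.d_add)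
     naturality := fun U V i => by
      ext f
      refine Cochain.ext_val (U := V.unop) fun A x hA hx hV => ?_
      refine (Cochain.val_d (U := V.unop) _ hA hx hV).trans ?_
      refine Eq.trans ?_ ((Cochain.val_map (Cochain.d f) i.unop.le hV).trans
        (Cochain.val_d f hA hx (i.unop.le hV))).symm
      exact Finset.sum_congr rfl fun a _ => Cochain.val_map f i.unop.le hV }⟩

theorem diff_apply (f : Cochain D l U) : (diff D l).hom.app (op U) f = f.d := rfl

theorem diff_diff (l : ℕ) : diff D l ≫ diff D (l + 1) = 0 := by
  ext U f
  exact Cochain.d_d f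

theorem locallyExact_diff (hcov : ∀ x, ∃ i, x ∈ D i) (l : ℕ) :
    AbSheaf.LocallyExact (diff D l) (diff D (l + 1)) := by
  intro U s hs x hx
  change Cochain D (l + 1) U at s
  change s.d = 0 at hs
  obtain ⟨i, hi⟩ := hcov x
  have hcoc : ∀ (B : Finset I) (y : X), B.card = l + 1 + 1 + 1 → y ∈ inter D B → y ∈ U →
      ∑ c ∈ B, s.val (B.erase c) y = 0 := by
    intro B y hB hy hU
    rw [← s.val_d hB hy hU, hs, Cochain.val_zero]
  refine ⟨U ⊓ D i, inf_le_left, ⟨hx, hi⟩,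
    Cochain.mk (fun A y => if i ∈ A then 0 else s.val (insert i A) y) ?_, ?_⟩
  · intro A y hA hy hU
    split_ifs with hiA
    · exact Eventually.of_forall fun _ => rfl
    · refine s.val_eventually (by rw [Finset.card_insert_of_notMem hiA, hA]) ?_ hU.1
      exact (mem_inter D).2 (by simpa using ⟨hU.2, hy⟩)
  · refine Cochain.ext_val (U := U ⊓ D i) fun B y hB hy hU => ?_
    rw [diff_apply, Cochain.val_map s inf_le_left hU, Cochain.val_d _ hB hy hU,
      ← sum_cone (fun B => s.val B y) i B]
    · refine Finset.sum_congr rfl fun b hb => ?_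
      exact Cochain.val_mk (by rw [Finset.card_erase_of_mem hb, hB]; rfl)
        (inter_anti D (B.erase_subset b) hy) hU
    · intro hiB
      refine hcoc _ y (by rw [Finset.card_insert_of_notMem hiB, hB]) ?_ hU.1
      exact (mem_inter D).2 (by simpa using ⟨hU.2, hy⟩)

theorem aug_diff : aug D ≫ diff D 0 = 0 := by
  ext U f
  refine Cochain.ext_val (U := U.unop) fun A x hA hx hU => ?_
  change LocallyConstant U.unop (ZMod 2) at f
  refine (Cochain.val_d (l := 0) (U := U.unop) _ hA hx hU).trans ?_
  have : ∀ a ∈ A, Cochain.val (l := 0) ((aug D).hom.app (op U.unop) f) (A.erase a) x = f ⟨x, hU⟩ :=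
    fun a ha => val_aug f (by rw [Finset.card_erase_of_mem ha, hA])
      (inter_anti D (A.erase_subset a) hx) hU
  refine (Finset.sum_congr rfl this).trans ?_
  rw [Finset.sum_const, hA]
  exact (CharTwo.two_nsmul _).trans (Cochain.val_zero (l := 1) A x).symm

theorem locallyExact_aug (hcov : ∀ x, ∃ i, x ∈ D i) :
    AbSheaf.LocallyExact (aug D) (diff D 0) := by
  intro U s hs x hx
  change Cochain D 0 U at s
  change s.d = 0 at hs
  obtain ⟨i, hi⟩ := hcov x
  let g : LocallyConstant (U ⊓ D i : Opens X) (ZMod 2) := ⟨fun y => s.val {i} y.1, by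
    refine (IsLocallyConstant.iff_eventually_eq _).2 fun y => ?_
    exact continuous_subtype_val.continuousAt.eventually (s.val_eventually rfl
      ((mem_inter D).2 (by simpa using y.2.2)) y.2.1)⟩
  refine ⟨U ⊓ D i, inf_le_left, ⟨hx, hi⟩, g, ?_⟩
  refine Cochain.ext_val (U := U ⊓ D i) fun B y hB hy hU => ?_
  rw [Cochain.val_map s inf_le_left hU, ← sum_cone (fun B => s.val B y) i B]
  · refine (val_aug g hB hy hU).trans ?_
    obtain ⟨j, rfl⟩ := Finset.card_eq_one.1 hB
    simp [g]
  · intro hiB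
    have hB' : (insert i B).card = 0 + 1 + 1 := by rw [Finset.card_insert_of_notMem hiB, hB]
    rw [← s.val_d hB' ((mem_inter D).2 (by simpa using ⟨hU.2, hy⟩)) hU.1, hs, Cochain.val_zero]

end Cech

end

section

open Opposite TopologicalSpace Topology Filter Limits

theorem HasClopenBasis.subtype {T : Type*} [TopologicalSpace T] (h : HasClopenBasis T)
    (p : T → Prop) : HasClopenBasis {x // p x} := by
  intro x W hW
  rw [nhds_subtype_eq_comap] at hW
  obtain ⟨V, hV, hVW⟩ := hW
  obtain ⟨C, hC, hxC, hCV⟩ := h x.1 V hV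
  exact ⟨Subtype.val ⁻¹' C, hC.preimage continuous_subtype_val, hxC,
    (Set.preimage_mono hCV).trans hVW⟩

theorem HasClopenBasis.sigma {ι : Type*} {T : ι → Type*} [∀ i, TopologicalSpace (T i)]
    (h : ∀ i, HasClopenBasis (T i)) : HasClopenBasis (Σ i, T i) := by
  rintro ⟨i, x⟩ W hW
  rw [Sigma.nhds_mk] at hW
  obtain ⟨C, hC, hxC, hCW⟩ := h i x _ hW
  exact ⟨Sigma.mk i '' C, ⟨isClosedMap_sigmaMk _ hC.1, isOpenMap_sigmaMk _ hC.2⟩, ⟨x, hxC, rfl⟩,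
    Set.image_subset_iff.2 hCW⟩

/-- `U` is the union of a disjoint family of compact open sets. -/
def IsCompactPartitioned {T : Type u} [TopologicalSpace T] (U : Set T) : Prop :=
  ∃ (ι : Type u) (K : ι → Set T), (∀ i, IsOpen (K i)) ∧ (∀ i, IsCompact (K i)) ∧
    (∀ i j x, x ∈ K i → x ∈ K j → i = j) ∧ ⋃ i, K i = U

namespace Cech

variable {X : TopCat.{u}} {I : Type} {D : I → Opens X}

theorem lcRefinable_preimage (hb : HasClopenBasis X)
    (hK : ∀ A : Finset I, A.Nonempty → IsCompactPartitioned (inter D A : Set X))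
    (l : ℕ) {W : Set X} (hW : IsClopen W) : LcRefinable (proj D l ⁻¹' W) := by
  have hK' : ∀ A : {A : Finset I // A.card = l + 1},
      IsCompactPartitioned (inter D A.1 : Set X) := fun A =>
    hK A.1 (Finset.card_pos.1 (by rw [A.2]; exact Nat.succ_pos l))
  choose ι K hKo hKc hKd hKu using hK'
  let L : (Σ A, ι A) → Set (Σ A : {A : Finset I // A.card = l + 1}, inter D A.1) :=
    fun a => Sigma.mk a.1 '' (Subtype.val ⁻¹' (K a.1 a.2 ∩ W))
  have hL : proj D l ⁻¹' W = ⋃ a, L a := by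
    ext ⟨A, x⟩
    refine Iff.trans ?_ Set.mem_iUnion.symm
    constructor
    · intro hx
      have : x.1 ∈ ⋃ i, K A i := by rw [hKu]; exact x.2
      obtain ⟨i, hi⟩ := Set.mem_iUnion.1 this
      exact ⟨⟨A, i⟩, x, ⟨hi, hx⟩, rfl⟩
    · rintro ⟨⟨B, i⟩, y, hy, hyx⟩
      obtain rfl : B = A := congrArg Sigma.fst hyx
      obtain rfl : y = x := eq_of_heq (Sigma.mk.inj hyx).2
      exact hy.2
  rw [hL]
  refine LcRefinable.iUnion (T := Σ A : {A : Finset I // A.card = l + 1}, inter D A.1)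
    (fun a => ?_) (fun a => ?_) ?_
  · refine IsCompact.lcRefinable (HasClopenBasis.sigma fun A => hb.subtype _) ?_
    refine IsCompact.image ?_ continuous_sigmaMk
    refine (IsInducing.subtypeVal.isCompact_preimage_iff ?_).2 ((hKc a.1 a.2).inter_right hW.1)
    intro x hx
    have : x ∈ ⋃ i, K a.1 i := Set.mem_iUnion_of_mem _ hx.1
    rw [hKu] at this
    exact ⟨⟨x, this⟩, rfl⟩
  · exact isOpenMap_sigmaMk _ (((hKo a.1 a.2).inter hW.2).preimage continuous_subtype_val)
  · rintro ⟨A, i⟩ ⟨B, j⟩ _ ⟨x, hx, rfl⟩ ⟨y, hy, hyx⟩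
    obtain rfl : B = A := congrArg Sigma.fst hyx
    obtain rfl : y = x := eq_of_heq (Sigma.mk.inj hyx).2
    rw [hKd B i j y.1 hx.1 hy.1]

theorem subsingleton_H_cochains (hb : HasClopenBasis X)
    (hK : ∀ A : Finset I, A.Nonempty → IsCompactPartitioned (inter D A : Set X)) (l q : ℕ) :
    Subsingleton (Sheaf.H (cochains D l) (q + 1)) := by
  refine AbSheaf.subsingleton_H_push (proj D l) ?_ ?_ q _
  · intro x U hx
    obtain ⟨C, hC, hxC, hCU⟩ := hb x U (U.isOpen.mem_nhds hx)
    exact ⟨⟨C, hC.2⟩, hxC, hCU, lcRefinable_preimage hb hK l hC⟩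
  · exact lcRefinable_preimage hb hK l isClopen_univ

variable [DecidableEq I]

/-- A global cochain that is a coboundary. -/
def IsCoboundary : ∀ {l : ℕ}, Cochain D l ⊤ → Prop
  | 0, z => z = 0
  | _ + 1, z => ∃ y : Cochain D _ ⊤, y.d = z

variable (D) in
/-- The group of global cocycles. -/
noncomputable def cocycles (l : ℕ) : AddSubgroup (Cochain D l ⊤) :=
  (AddMonoidHom.mk' (Cochain.d (D := D) (l := l) (U := ⊤)) Cochain.d_add).ker

theorem mem_cocycles {l : ℕ} {z : Cochain D l ⊤} : z ∈ cocycles D l ↔ z.d = 0 := Iff.rfl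

/-- Čech cocycles modulo coboundaries compute the cohomology of the constant sheaf `ℤ/2`. -/
theorem exists_cocycles_to_H (hb : HasClopenBasis X) (hcov : ∀ x, ∃ i, x ∈ D i)
    (hK : ∀ A : Finset I, A.Nonempty → IsCompactPartitioned (inter D A : Set X)) (m : ℕ) :
    ∃ π : cocycles D m →+ Sheaf.H (Cuboid.constZ2 X) m, Function.Surjective π ∧
      ∀ z, π z = 0 ↔ IsCoboundary z.1 := by
  have : Epi (kernel.lift (diff D 0) (aug D) aug_diff) := (locallyExact_aug hcov).epi_lift aug_diff
  have : Mono (kernel.lift (diff D 0) (aug D) aug_diff ≫ kernel.ι (diff D 0)) := by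
    rw [kernel.lift_ι]
    exact mono_aug hcov
  have : Mono (kernel.lift (diff D 0) (aug D) aug_diff) := mono_of_mono _ (kernel.ι (diff D 0))
  have : IsIso (kernel.lift (diff D 0) (aug D) aug_diff) := isIso_of_mono_of_epi _
  obtain ⟨e⟩ := nonempty_constZ2_iso_lcSheaf X
  let E := AbSheaf.hCongr (e ≪≫ asIso (kernel.lift (diff D 0) (aug D) aug_diff)) m
  suffices h : ∃ π : cocycles D m →+ Sheaf.H (kernel (diff D 0)) m, Function.Surjective π ∧
      ∀ z, π z = 0 ↔ IsCoboundary z.1 by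
    obtain ⟨π, hπ, hker⟩ := h
    refine ⟨E.symm.toAddMonoidHom.comp π, E.symm.surjective.comp hπ, fun z => ?_⟩
    rw [← hker]
    exact E.symm.map_eq_zero_iff
  cases m with
  | zero =>
    have hT : IsTerminal (⊤ : Opens X) := isTerminalTop
    let F : Sheaf.H (kernel (diff D 0)) 0 ≃+ cocycles D 0 :=
      (Sheaf.H.equiv₀ (kernel (diff D 0)) hT).trans (AbSheaf.kernelSections (diff D 0) ⊤)
    refine ⟨F.symm.toAddMonoidHom, F.symm.surjective, fun z => ?_⟩
    refine F.symm.map_eq_zero_iff.trans ?_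
    exact Subtype.ext_iff
  | succ m =>
    obtain ⟨π, hπ, hker⟩ := AbSheaf.exists_cocycles_to_H (C := cochains D) (d := diff D)
      diff_diff (locallyExact_diff hcov) (subsingleton_H_cochains hb hK) m 0 m (zero_add m)
    exact ⟨π, hπ, hker⟩

end Cech

end

section

open Opposite TopologicalSpace Topology Filter

theorem HasClopenBasis.of_profinite (T : Type*) [TopologicalSpace T] [CompactSpace T] [T2Space T]
    [TotallyDisconnectedSpace T] : HasClopenBasis T := fun _ _ hW =>
  isTopologicalBasis_isClopen.mem_nhds_iff.1 hW

theorem OnePoint.continuous_of_finite_fibers {S T : Type*} [TopologicalSpace S]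
    [DiscreteTopology S] [TopologicalSpace T] [DiscreteTopology T] (f : OnePoint S → OnePoint T)
    (h0 : f OnePoint.infty = OnePoint.infty) (hf : ∀ t : T, {s : S | f s = t}.Finite) :
    Continuous f := by
  rw [OnePoint.continuous_iff_from_discrete, h0, OnePoint.hasBasis_nhds_infty.tendsto_right_iff]
  rintro K ⟨-, hK⟩
  have hfin : (⋃ t ∈ K, {s : S | f s = t}).Finite :=
    (isCompact_iff_finite.1 hK).biUnion fun t _ => hf t
  filter_upwards [hfin.compl_mem_cofinite] with s hs
  by_cases h : f s = OnePoint.infty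
  · exact Or.inr h
  · obtain ⟨t, ht⟩ := OnePoint.ne_infty_iff_exists.1 h
    refine Or.inl ⟨t, fun htK => hs ?_, ht⟩
    exact Set.mem_biUnion htK ht.symm

namespace Cuboid

variable {n : ℕ}

/-- The underlying point of the product. -/
def pt {κ : Fin (n + 1) → Cardinal.{u}} (x : Punctured κ) : Space κ := x.1

theorem continuous_pt {κ : Fin (n + 1) → Cardinal.{u}} : Continuous (pt (κ := κ)) :=
  continuous_subtype_val

theorem continuous_pt_apply {κ : Fin (n + 1) → Cardinal.{u}} (i : Fin (n + 1)) :
    Continuous fun x : Punctured κ => pt x i := (continuous_apply i).comp continuous_pt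

theorem hasClopenBasis_punctured (κ : Fin (n + 1) → Cardinal.{u}) :
    HasClopenBasis (Punctured κ) :=
  (HasClopenBasis.of_profinite (Space κ)).subtype _

/-- The open set of points whose coordinate with index `i` is finite. -/
def finCoord (κ : Fin (n + 1) → Cardinal.{u}) (i : Fin (n + 1)) : Opens (Punctured κ) :=
  ⟨{x | pt x i ≠ OnePoint.infty},
    (isClosed_singleton (x := OnePoint.infty)).isOpen_compl.preimage (continuous_pt_apply i)⟩

theorem mem_finCoord {κ : Fin (n + 1) → Cardinal.{u}} {i : Fin (n + 1)} {x : Punctured κ} :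
    x ∈ finCoord κ i ↔ pt x i ≠ OnePoint.infty := Iff.rfl

theorem exists_mem_finCoord {κ : Fin (n + 1) → Cardinal.{u}} (x : Punctured κ) :
    ∃ i, x ∈ finCoord κ i := by
  by_contra! h
  exact x.2 (funext fun i => not_not.1 (h i))

theorem isOpen_singleton_of_ne_infty {c : Cardinal.{u}} {a : OnePoint (Disc c)}
    (ha : a ≠ OnePoint.infty) : IsOpen {a} := by
  obtain ⟨z, rfl⟩ := OnePoint.ne_infty_iff_exists.1 ha
  rw [← Set.image_singleton, OnePoint.isOpen_image_coe]
  exact isOpen_discrete _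

theorem eventually_coord_eq {κ : Fin (n + 1) → Cardinal.{u}} {x : Punctured κ} {i : Fin (n + 1)}
    (hi : x ∈ finCoord κ i) : ∀ᶠ y : Punctured κ in 𝓝 x, pt y i = pt x i :=
  (continuous_pt_apply i).continuousAt.eventually
    ((isOpen_singleton_of_ne_infty hi).mem_nhds rfl)

theorem isCompactPartitioned_inter (κ : Fin (n + 1) → Cardinal.{u}) (A : Finset (Fin (n + 1)))
    (hA : A.Nonempty) : IsCompactPartitioned (Cech.inter (finCoord κ) A : Set (Punctured κ)) := by
  refine ⟨∀ i : A, Disc (κ i), fun z => {x | ∀ i : A, pt x i = (z i : OnePoint _)}, fun z => ?_,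
    fun z => ?_, fun z w x hz hw => ?_, ?_⟩
  · refine isOpen_iff_mem_nhds.2 fun x hx => ?_
    have : ∀ᶠ y : Punctured κ in 𝓝 x, ∀ i : A, pt y i = pt x i :=
      Filter.eventually_all.2 fun i => eventually_coord_eq (mem_finCoord.2 (by
        rw [hx i]; exact OnePoint.coe_ne_infty _))
    filter_upwards [this] with y hy i
    rw [hy i, hx i]
  · have hcl : IsClosed {x : Space κ | ∀ i : A, x i = (z i : OnePoint _)} := by
      simp only [Set.ofPred_forall]
      exact isClosed_iInter fun i => isClosed_eq (continuous_apply _) continuous_const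
    refine (IsInducing.subtypeVal.isCompact_preimage_iff
      (K := {x : Space κ | ∀ i : A, x i = (z i : OnePoint _)}) ?_).2 hcl.isCompact
    intro x hx
    obtain ⟨i, hi⟩ := hA
    refine ⟨⟨x, fun h => ?_⟩, rfl⟩
    have := hx ⟨i, hi⟩
    rw [h] at this
    exact OnePoint.infty_ne_coe _ this
  · funext i
    exact OnePoint.coe_injective ((hz i).symm.trans (hw i))
  · ext x
    refine Set.mem_iUnion.trans ⟨?_, fun hx => ?_⟩
    · rintro ⟨z, hz⟩ i hi
      rw [mem_finCoord, hz ⟨i, hi⟩]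
      exact OnePoint.coe_ne_infty _
    · choose z hz using fun i : A => OnePoint.ne_infty_iff_exists.1 (hx i.1 i.2)
      exact ⟨z, fun i => (hz i).symm⟩

/-- The cohomology of the punctured cuboid by Čech cocycles. -/
theorem exists_cocycles_to_H (κ : Fin (n + 1) → Cardinal.{u}) (m : ℕ) :
    ∃ π : Cech.cocycles (finCoord κ) m →+ H m κ, Function.Surjective π ∧
      ∀ z, π z = 0 ↔ Cech.IsCoboundary z.1 :=
  Cech.exists_cocycles_to_H (hasClopenBasis_punctured κ) exists_mem_finCoord
    (isCompactPartitioned_inter κ) m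

section Fubini

variable {κ : Fin (n + 1) → Cardinal.{u}} {k : ℤ} {Y : Fin (n + 1) → Set (Space κ)}

theorem IsFubini.nonneg (hk : -1 ≤ k) (hY : IsFubini κ k Y) : 0 ≤ k := by
  by_contra! h
  obtain rfl : k = -1 := by omega
  obtain ⟨E, hE⟩ := hY.nbhd ∅ (by simp) (inftyPt κ) (fun i => by simp [inftyPt])
  have : inftyPt κ ∈ Nbhd κ ∅ (inftyPt κ) E := ⟨by simp, fun j _ => Or.inl rfl⟩
  simpa using hE this

theorem IsFubini.exists_mem (hY : IsFubini κ k Y) (x : Punctured κ) : ∃ i, pt x ∈ Y i := by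
  have : pt x ∈ ⋃ i, Y i := by rw [hY.cover]; exact x.2
  exact Set.mem_iUnion.1 this

/-- The index of the piece of the partition that contains a point. -/
noncomputable def IsFubini.idx (hY : IsFubini κ k Y) (x : Punctured κ) : Fin (n + 1) :=
  (hY.exists_mem x).choose

theorem IsFubini.mem_idx (hY : IsFubini κ k Y) (x : Punctured κ) : pt x ∈ Y (hY.idx x) :=
  (hY.exists_mem x).choose_spec

theorem IsFubini.mem_iff (hY : IsFubini κ k Y) {x : Punctured κ} {i : Fin (n + 1)} :
    pt x ∈ Y i ↔ hY.idx x = i := by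
  refine ⟨fun h => ?_, fun h => h ▸ hY.mem_idx x⟩
  by_contra hne
  exact Set.disjoint_left.1 (hY.disjoint hne) (hY.mem_idx x) h

variable {A : Finset (Fin (n + 1))} {x : Punctured κ}

theorem IsFubini.mem_finCoord_idx (hY : IsFubini κ k Y) (hA : k + 1 ≤ (A.card : ℤ))
    (hx : x ∈ Cech.inter (finCoord κ) A) : x ∈ finCoord κ (hY.idx x) := by
  classical
  let B : Finset (Fin (n + 1)) := Finset.univ.filter fun i => pt x i ≠ OnePoint.infty
  have hB : ∀ i, pt x i ≠ OnePoint.infty ↔ i ∈ B := fun i => by simp [B]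
  have hAB : A ⊆ B := fun i hi => (hB i).1 (hx i hi)
  obtain ⟨E, hE⟩ := hY.nbhd B (hA.trans (by exact_mod_cast Finset.card_le_card hAB)) (pt x) hB
  have hmem : pt x ∈ Nbhd κ B (pt x) E :=
    ⟨fun _ _ => rfl, fun j hj => Or.inl (not_not.1 fun h => hj ((hB j).1 h))⟩
  obtain ⟨i, hi, hxi⟩ := Set.mem_iUnion₂.1 (hE hmem)
  rw [mem_finCoord, hY.mem_iff.1 hxi]
  exact (hB i).2 hi

theorem IsFubini.eventually_iff (hY : IsFubini κ k Y) (hA : k + 1 ≤ (A.card : ℤ))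
    (hx : x ∈ Cech.inter (finCoord κ) A) {i : Fin (n + 1)} (hi : i ∉ A) :
    ∀ᶠ y : Punctured κ in 𝓝 x, (hY.idx y = i ↔ hY.idx x = i) := by
  have hcl := hY.clopen A hA i hi
  have hxD : pt x ∈ D κ A := hx
  have h1 : ∀ᶠ y : D κ A in 𝓝 ⟨pt x, hxD⟩, ((y : Space κ) ∈ Y i ↔ pt x ∈ Y i) := by
    by_cases h : pt x ∈ Y i
    · filter_upwards [hcl.isOpen.mem_nhds (show (⟨pt x, hxD⟩ : D κ A) ∈ _ from h)] with y hy
      exact iff_of_true hy h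
    · filter_upwards [hcl.compl.isOpen.mem_nhds (show (⟨pt x, hxD⟩ : D κ A) ∈ _ from h)] with y hy
      exact iff_of_false hy h
  rw [nhds_subtype_eq_comap, Filter.eventually_comap] at h1
  filter_upwards [continuous_pt.continuousAt.eventually h1,
    (Cech.inter (finCoord κ) A).isOpen.mem_nhds hx] with y hy hyA
  rw [← hY.mem_iff, ← hY.mem_iff]
  exact hy ⟨pt y, hyA⟩ rfl

theorem IsFubini.eventually_idx_eq (hY : IsFubini κ k Y) (hA : k + 1 ≤ (A.card : ℤ))
    (hx : x ∈ Cech.inter (finCoord κ) A) (hi : hY.idx x ∉ A) :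
    ∀ᶠ y : Punctured κ in 𝓝 x, hY.idx y = hY.idx x :=
  (hY.eventually_iff hA hx hi).mono fun _ h => h.2 rfl

theorem IsFubini.eventually_idx_mem (hY : IsFubini κ k Y) (hA : k + 1 ≤ (A.card : ℤ))
    (hx : x ∈ Cech.inter (finCoord κ) A) (hi : hY.idx x ∈ A) :
    ∀ᶠ y : Punctured κ in 𝓝 x, hY.idx y ∈ A := by
  have h : ∀ᶠ y : Punctured κ in 𝓝 x, ∀ i : Fin (n + 1), i ∉ A → hY.idx y ≠ i := by
    refine Filter.eventually_all.2 fun i => ?_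
    by_cases hiA : i ∈ A
    · exact Filter.Eventually.of_forall fun _ h => (h hiA).elim
    · exact (hY.eventually_iff hA hx hiA).mono fun y hy _ hyi =>
        hiA (hy.1 hyi ▸ hi)
  filter_upwards [h] with y hy
  by_contra hne
  exact hy _ hne rfl

theorem IsFubini.mem_inter_insert (hY : IsFubini κ k Y) (hA : k + 1 ≤ (A.card : ℤ))
    (hx : x ∈ Cech.inter (finCoord κ) A) : x ∈ Cech.inter (finCoord κ) (insert (hY.idx x) A) := by
  rw [Cech.mem_inter, Finset.forall_mem_insert]
  exact ⟨hY.mem_finCoord_idx hA hx, hx⟩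

variable {l : ℕ}

/-- The contraction of the Čech complex defined by a Fubini partition. -/
noncomputable def IsFubini.cone (hY : IsFubini κ k Y) (hl : k ≤ l)
    (f : Cech.Cochain (finCoord κ) (l + 1) ⊤) : Cech.Cochain (finCoord κ) l ⊤ :=
  Cech.Cochain.mk
    (fun A x => if hY.idx x ∈ A then 0 else f.val (insert (hY.idx x) A) x) fun A x hA hx _ => by
    have hA' : k + 1 ≤ (A.card : ℤ) := by rw [hA]; push_cast; omega
    by_cases hi : hY.idx x ∈ A
    · filter_upwards [hY.eventually_idx_mem hA' hx hi] with y hy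
      rw [if_pos hi, if_pos hy]
    · filter_upwards [hY.eventually_idx_eq hA' hx hi, f.val_eventually
        (A := insert (hY.idx x) A) (by rw [Finset.card_insert_of_notMem hi, hA])
        (hY.mem_inter_insert hA' hx) trivial] with y hy hy'
      rw [hy, if_neg hi, if_neg hi, hy']

theorem IsFubini.val_cone (hY : IsFubini κ k Y) (hl : k ≤ l)
    (f : Cech.Cochain (finCoord κ) (l + 1) ⊤) (hA : A.card = l + 1)
    (hx : x ∈ Cech.inter (finCoord κ) A) : (hY.cone hl f).val A x =
      if hY.idx x ∈ A then 0 else f.val (insert (hY.idx x) A) x :=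
  Cech.Cochain.val_mk hA hx trivial

theorem IsFubini.d_cone (hY : IsFubini κ k Y) (hl : k ≤ l)
    (f : Cech.Cochain (finCoord κ) (l + 1) ⊤) (hf : f.d = 0) : (hY.cone hl f).d = f := by
  refine Cech.Cochain.ext_val fun B x hB hx hU => ?_
  rw [Cech.Cochain.val_d _ hB hx hU, ← Cech.sum_cone (fun B => f.val B x) (hY.idx x) B]
  · refine Finset.sum_congr rfl fun b hb => ?_
    exact hY.val_cone hl f (by rw [Finset.card_erase_of_mem hb, hB]; rfl)
      (Cech.inter_anti _ (B.erase_subset b) hx)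
  · intro hiB
    rw [← f.val_d (by rw [Finset.card_insert_of_notMem hiB, hB])
      (hY.mem_inter_insert (by rw [hB]; push_cast; omega) hx) hU, hf, Cech.Cochain.val_zero]

theorem IsFubini.subsingleton_H (hk : -1 ≤ k) (hY : IsFubini κ k Y) (m : ℕ) (hm : k + 1 ≤ (m : ℤ)) :
    Subsingleton (H m κ) := by
  have hk0 := hY.nonneg hk
  obtain ⟨π, hπ, hker⟩ := exists_cocycles_to_H κ m
  refine subsingleton_of_forall_eq 0 fun a => ?_
  obtain ⟨z, rfl⟩ := hπ a
  obtain ⟨l, rfl⟩ : ∃ l, m = l + 1 := ⟨m - 1, by omega⟩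
  exact (hker z).2 ⟨hY.cone (l := l) (by push_cast at hm; omega) z.1, hY.d_cone _ _ z.2⟩

end Fubini

end Cuboid

end

section

open Opposite TopologicalSpace Topology Filter

/-- If `Z` has exponent two, a quotient of `Z'` embeds in a quotient of `Z` as soon as a surjection
`Z → Z'` descends to the quotients. -/
theorem exists_injective_of_surjective_cover {Z Z' H H' : Type*} [AddCommGroup Z] [AddCommGroup Z']
    [AddCommGroup H] [AddCommGroup H'] (π : Z →+ H) (hπ : Function.Surjective π)
    (π' : Z' →+ H') (hπ' : Function.Surjective π') (R : Z →+ Z') (hR : Function.Surjective R)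
    (hker : ∀ z, π z = 0 → π' (R z) = 0) (h2 : ∀ z : Z, 2 • z = 0) :
    ∃ φ : H' →+ H, Function.Injective φ := by
  let f : H →+ H' := π.liftOfSurjective hπ ⟨π'.comp R, fun z hz => hker z hz⟩
  have hf : ∀ z, f (π z) = π' (R z) := fun z =>
    π.liftOfRightInverse_comp_apply _ _ ⟨π'.comp R, fun z hz => hker z hz⟩ z
  have hfs : Function.Surjective f := fun y => by
    obtain ⟨z', rfl⟩ := hπ' y
    obtain ⟨z, rfl⟩ := hR z'
    exact ⟨π z, hf z⟩
  have h2H : ∀ x : H, 2 • x = 0 := fun x => by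
    obtain ⟨z, rfl⟩ := hπ x
    rw [← map_nsmul, h2, map_zero]
  have h2H' : ∀ x : H', 2 • x = 0 := fun x => by
    obtain ⟨z, rfl⟩ := hfs x
    rw [← map_nsmul, h2H, map_zero]
  let _ : Module (ZMod 2) H := AddCommGroup.zmodModule h2H
  let _ : Module (ZMod 2) H' := AddCommGroup.zmodModule h2H'
  obtain ⟨g, hg⟩ := (f.toZModLinearMap 2).exists_rightInverse_of_surjective
    (LinearMap.range_eq_top.2 hfs)
  exact ⟨g.toAddMonoidHom, Function.LeftInverse.injective (g := f) fun x => LinearMap.congr_fun hg x⟩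

namespace Cuboid

section OneCoordinate

variable {S T : Type*}

/-- The extension of an injection to one-point compactifications. -/
def extendInfty (e : S ↪ T) : OnePoint S → OnePoint T := OnePoint.map e

theorem continuous_extendInfty [TopologicalSpace S] [DiscreteTopology S] [TopologicalSpace T]
    [DiscreteTopology T] (e : S ↪ T) : Continuous (extendInfty e) :=
  OnePoint.continuous_of_finite_fibers _ rfl fun t =>
    Set.Subsingleton.finite fun a ha _ hb =>
      e.injective (OnePoint.coe_injective ((ha : (e a : OnePoint T) = t).trans hb.symm))

open Classical in
/-- The retraction onto the compactification of a subset, collapsing the rest to `∞`. -/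
noncomputable def retractInfty (e : S ↪ T) : OnePoint T → OnePoint S :=
  fun a => if h : ∃ s : S, a = (e s : OnePoint T) then (h.choose : OnePoint S) else OnePoint.infty

theorem retractInfty_coe (e : S ↪ T) (s : S) : retractInfty e (e s : OnePoint T) = s := by
  have h : ∃ s' : S, ((e s : T) : OnePoint T) = (e s' : OnePoint T) := ⟨s, rfl⟩
  unfold retractInfty
  rw [dif_pos h]
  exact congrArg _ (e.injective (OnePoint.coe_injective h.choose_spec)).symm

theorem retractInfty_infty (e : S ↪ T) : retractInfty e OnePoint.infty = OnePoint.infty :=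
  dif_neg fun ⟨_, h⟩ => OnePoint.infty_ne_coe _ h

theorem retractInfty_extendInfty (e : S ↪ T) (a : OnePoint S) :
    retractInfty e (extendInfty e a) = a := by
  induction a using OnePoint.rec with
  | infty => exact retractInfty_infty e
  | coe s => exact retractInfty_coe e s

theorem continuous_retractInfty [TopologicalSpace S] [DiscreteTopology S] [TopologicalSpace T]
    [DiscreteTopology T] (e : S ↪ T) : Continuous (retractInfty e) := by
  refine OnePoint.continuous_of_finite_fibers _ (retractInfty_infty e) fun s =>
    (Set.finite_singleton (e s)).subset fun t ht => ?_
  by_cases h : ∃ s' : S, (t : OnePoint T) = (e s' : OnePoint T)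
  · obtain ⟨s', hs'⟩ := h
    have ht' : retractInfty e (t : OnePoint T) = s := ht
    rw [hs', retractInfty_coe] at ht'
    rw [OnePoint.coe_injective hs', OnePoint.coe_injective ht']
    rfl
  · exact absurd ((dif_neg h).symm.trans ht) (OnePoint.infty_ne_coe s)

end OneCoordinate

section Restriction

variable {n : ℕ} {κ μ : Fin (n + 1) → Cardinal.{u}} (e : ∀ i, Disc (μ i) ↪ Disc (κ i))

/-- The closed embedding of a smaller punctured cuboid. -/
def incl (x : Punctured μ) : Punctured κ :=
  ⟨fun i => extendInfty (e i) (pt x i), fun h => x.2 (funext fun i => by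
    have := congrArg (retractInfty (e i)) (congrFun h i)
    rw [retractInfty_extendInfty] at this
    exact this.trans (retractInfty_infty (e i)))⟩

theorem continuous_incl : Continuous (incl e) :=
  Continuous.subtype_mk
    (continuous_pi fun i => (continuous_extendInfty (e i)).comp (continuous_pt_apply i)) _

/-- The retraction of the larger cuboid onto the smaller one. -/
noncomputable def retract (x : Space κ) : Space μ := fun i => retractInfty (e i) (x i)

theorem continuous_retract : Continuous (retract e) :=
  continuous_pi fun i => (continuous_retractInfty (e i)).comp (continuous_apply i)

theorem retract_incl (x : Punctured μ) : retract e (pt (incl e x)) = pt x :=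
  funext fun i => retractInfty_extendInfty (e i) _

theorem incl_mem_inter {A : Finset (Fin (n + 1))} {x : Punctured μ} :
    incl e x ∈ Cech.inter (finCoord κ) A ↔ x ∈ Cech.inter (finCoord μ) A := by
  refine forall₂_congr fun i _ => not_congr ⟨fun h => ?_, fun h => ?_⟩
  · rw [← retract_incl e x]
    exact (congrArg (retractInfty (e i)) h).trans (retractInfty_infty (e i))
  · exact congrArg (extendInfty (e i)) h

variable {l : ℕ}

/-- Restriction of cochains to a smaller punctured cuboid. -/
noncomputable def res (f : Cech.Cochain (finCoord κ) l ⊤) : Cech.Cochain (finCoord μ) l ⊤ :=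
  Cech.Cochain.mk (fun A x => f.val A (incl e x)) fun _ _ hA hx _ =>
    (continuous_incl e).continuousAt.eventually
      (f.val_eventually hA ((incl_mem_inter e).2 hx) trivial)

theorem val_res (f : Cech.Cochain (finCoord κ) l ⊤) {A : Finset (Fin (n + 1))} {x : Punctured μ}
    (hA : A.card = l + 1) (hx : x ∈ Cech.inter (finCoord μ) A) :
    (res e f).val A x = f.val A (incl e x) :=
  Cech.Cochain.val_mk hA hx trivial

theorem res_add (f g : Cech.Cochain (finCoord κ) l ⊤) : res e (f + g) = res e f + res e g := by
  refine Cech.Cochain.ext_val fun A x hA hx _ => ?_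
  simp only [Cech.Cochain.val_add, val_res e _ hA hx]

theorem d_res (f : Cech.Cochain (finCoord κ) l ⊤) : (res e f).d = res e f.d := by
  refine Cech.Cochain.ext_val fun A x hA hx hU => ?_
  rw [Cech.Cochain.val_d _ hA hx hU, val_res e _ hA hx,
    f.val_d hA ((incl_mem_inter e).2 hx) trivial]
  exact Finset.sum_congr rfl fun a ha => val_res e _
    (by rw [Finset.card_erase_of_mem ha, hA]; rfl) (Cech.inter_anti _ (A.erase_subset a) hx)

theorem isCoboundary_res {f : Cech.Cochain (finCoord κ) l ⊤} (hf : Cech.IsCoboundary f) :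
    Cech.IsCoboundary (res e f) := by
  cases l with
  | zero =>
    obtain rfl : f = 0 := hf
    refine Cech.Cochain.ext_val fun A x hA hx _ => ?_
    rw [val_res e _ hA hx, Cech.Cochain.val_zero, Cech.Cochain.val_zero]
  | succ l =>
    obtain ⟨y, rfl⟩ := hf
    exact ⟨res e y, d_res e y⟩

open Classical in
/-- Extension of cochains from a smaller punctured cuboid through the retraction. -/
noncomputable def extend (g : Cech.Cochain (finCoord μ) l ⊤) : Cech.Cochain (finCoord κ) l ⊤ :=
  Cech.Cochain.mk (fun A x => if h : retract e (pt x) ≠ inftyPt μ then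
      g.val A (⟨retract e (pt x), h⟩ : Punctured μ) else 0) fun A x hA hx _ => by
    have hc : Continuous fun y : Punctured κ => retract e (pt y) :=
      (continuous_retract e).comp continuous_pt
    by_cases hr : ∀ i ∈ A, retract e (pt x) i ≠ OnePoint.infty
    · obtain ⟨i, hi⟩ : A.Nonempty := Finset.card_pos.1 (by rw [hA]; exact Nat.succ_pos l)
      have hne : retract e (pt x) ≠ inftyPt μ := fun h => hr i hi (congrFun h i)
      have h1 : ∀ᶠ z : Punctured μ in 𝓝 ⟨retract e (pt x), hne⟩,
          g.val A z = g.val A ⟨retract e (pt x), hne⟩ := g.val_eventually hA hr trivial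
      have h2 : ∀ᶠ z : Space μ in 𝓝 (retract e (pt x)), ∀ hz : z ≠ inftyPt μ,
          g.val A (⟨z, hz⟩ : Punctured μ) = g.val A (⟨retract e (pt x), hne⟩ : Punctured μ) := by
        have h1' : ∀ᶠ z : {z : Space μ // z ≠ inftyPt μ} in 𝓝 ⟨retract e (pt x), hne⟩,
          g.val A (z : Punctured μ) = g.val A (⟨retract e (pt x), hne⟩ : Punctured μ) := h1
        rw [nhds_subtype_eq_comap, Filter.eventually_comap] at h1'
        exact h1'.mono fun z hz hz' => hz ⟨z, hz'⟩ rfl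
      filter_upwards [hc.continuousAt.eventually h2,
        (isClosed_singleton.isOpen_compl.preimage hc).mem_nhds hne] with y hy hy'
      have hy'' : retract e (pt y) ≠ inftyPt μ := hy'
      rw [dif_pos hne, dif_pos hy'']
      exact hy hy''
    · push Not at hr
      obtain ⟨i, hi, hri⟩ := hr
      have hzero : ∀ y : Punctured κ, retract e (pt y) i = OnePoint.infty →
          (if h : retract e (pt y) ≠ inftyPt μ then
            g.val A (⟨retract e (pt y), h⟩ : Punctured μ) else 0) = 0 := by
        intro y hy
        split_ifs with h
        · exact dif_neg fun h' => h'.2.1 i hi hy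
        · rfl
      filter_upwards [eventually_coord_eq (hx i hi)] with y hy
      rw [hzero x hri, hzero y ((congrArg (retractInfty (e i)) hy).trans hri)]

theorem val_extend_incl (g : Cech.Cochain (finCoord μ) l ⊤) {A : Finset (Fin (n + 1))}
    {x : Punctured μ} (hA : A.card = l + 1) (hx : x ∈ Cech.inter (finCoord μ) A) :
    (extend e g).val A (incl e x) = g.val A x := by
  have h : retract e (pt (incl e x)) ≠ inftyPt μ := by
    rw [retract_incl]
    exact x.2
  refine (Cech.Cochain.val_mk (U := ⊤) hA ((incl_mem_inter e).2 hx) trivial).trans ?_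
  rw [dif_pos h]
  exact congrArg (g.val A) (Subtype.ext (retract_incl e x))

theorem res_extend (g : Cech.Cochain (finCoord μ) l ⊤) : res e (extend e g) = g :=
  Cech.Cochain.ext_val fun _ _ hA hx _ => (val_res e _ hA hx).trans (val_extend_incl e g hA hx)

/-- Under a Fubini partition every cocycle on a smaller punctured cuboid extends. -/
theorem IsFubini.exists_cocycle_res {k : ℤ} {Y : Fin (n + 1) → Set (Space κ)}
    (hY : IsFubini κ k Y) (hl : k ≤ l) (g : Cech.Cochain (finCoord μ) l ⊤) (hg : g.d = 0) :
    ∃ f : Cech.Cochain (finCoord κ) l ⊤, f.d = 0 ∧ res e f = g := by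
  refine ⟨extend e g + hY.cone hl (extend e g).d, ?_, ?_⟩
  · rw [Cech.Cochain.d_add, hY.d_cone hl _ (Cech.Cochain.d_d _)]
    refine Cech.Cochain.ext_val fun A x _ _ _ => ?_
    rw [Cech.Cochain.val_add, Cech.Cochain.val_zero, CharTwo.add_self_eq_zero]
  · rw [res_add, res_extend]
    refine Cech.Cochain.ext_val fun A x hA hx hU => ?_
    have hx' := (incl_mem_inter e).2 hx
    rw [Cech.Cochain.val_add, val_res e _ hA hx, hY.val_cone hl _ hA hx']
    split_ifs with hi
    · exact add_zero _
    · have hB : (insert (hY.idx (incl e x)) A).card = l + 1 + 1 := by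
        rw [Finset.card_insert_of_notMem hi, hA]
      have hxB := (incl_mem_inter e).1
        (hY.mem_inter_insert (by rw [hA]; push_cast; omega) hx')
      rw [← val_res e _ hB hxB, ← d_res, res_extend, hg, Cech.Cochain.val_zero, add_zero]

theorem IsFubini.exists_injective_H {k : ℤ} {Y : Fin (n + 1) → Set (Space κ)}
    (hY : IsFubini κ k Y) {m : ℕ} (hm : k ≤ m) (hμ : ∀ i, μ i ≤ κ i) :
    ∃ φ : H m μ →+ H m κ, Function.Injective φ := by
  let e : ∀ i, Disc (μ i) ↪ Disc (κ i) := fun i => (Cardinal.out_embedding.1 (hμ i)).some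
  obtain ⟨π, hπ, hker⟩ := exists_cocycles_to_H κ m
  obtain ⟨π', hπ', hker'⟩ := exists_cocycles_to_H μ m
  let R : Cech.cocycles (finCoord κ) m →+ Cech.cocycles (finCoord μ) m :=
    AddMonoidHom.mk' (fun z => ⟨res e z.1, by
      have hz : z.1.d = 0 := z.2
      rw [Cech.mem_cocycles, d_res, hz]
      exact Cech.Cochain.ext_val fun A x hA hx _ => by
        rw [val_res e _ hA hx, Cech.Cochain.val_zero, Cech.Cochain.val_zero]⟩)
      fun a b => Subtype.ext (res_add e a.1 b.1)
  refine exists_injective_of_surjective_cover π hπ π' hπ' R ?_ ?_ ?_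
  · rintro ⟨g, hg⟩
    obtain ⟨f, hf, hfg⟩ := hY.exists_cocycle_res e hm g hg
    exact ⟨⟨f, hf⟩, Subtype.ext hfg⟩
  · intro z hz
    exact (hker' _).2 (isCoboundary_res e ((hker z).1 hz))
  · intro z
    refine Subtype.ext (Cech.Cochain.ext_val fun A x _ _ _ => ?_)
    rw [two_nsmul]
    exact (Cech.Cochain.val_add z.1 z.1 A x).trans
      ((CharTwo.add_self_eq_zero _).trans (Cech.Cochain.val_zero A x).symm)

end Restriction

end Cuboid

end

theorem theorem2 {n : ℕ} (κ : Fin (n + 1) → Cardinal.{u}) (k : ℤ) (hk : -1 ≤ k) (hkn : k ≤ n)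
    (hκ : ∃ Y : Fin (n + 1) → Set (Cuboid.Space κ), Cuboid.IsFubini κ k Y) :
    (∀ m : ℕ, k + 1 ≤ (m : ℤ) → Subsingleton (Cuboid.H m κ)) ∧
    (∀ m : ℕ, (m : ℤ) = k → ∀ μ : Fin (n + 1) → Cardinal.{u}, (∀ i, μ i ≤ κ i) →
      ∃ φ : Cuboid.H m μ →+ Cuboid.H m κ, Function.Injective φ) := by
  obtain ⟨Y, hY⟩ := hκ
  exact ⟨fun m hm => hY.subsingleton_H hk m hm, fun m hm μ hμ => hY.exists_injective_H hm.ge hμ⟩
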